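/- Let $B,\Delta\ge 1$ be integers such that $D=\Delta B$ is a power of two. For $L\ge 0$ let $\mathrm{clip}_L(z)=z$ if $\|z\|_2\le L$ and $\mathrm{clip}_L(z)=\frac{L}{\|z\|_2}z$ otherwise. For $v=(v_1,\dots,v_\Delta)\in\mathbb R^D$ with consecutive blocks $v_i\in\mathbb R^B$ let $$\mathtt{blkclip}_B(v)=\bigl(\mathrm{clip}_{\sqrt{B/D}}(v_1),\dots,\mathrm{clip}_{\sqrt{B/D}}(v_\Delta)\bigr).$$ Let $W=SHT\in\mathbb R^{D\times D}$ be random, where $H$ is the orthonormal (Walsh–)Hadamard matrix, $H_{ij}=D^{-1/2}(-1)^{\langle i,j\rangle}$ for $0\le i,j<D$ with $\langle i,j\rangle$ the inner product of the binary digit vectors of $i$ and $j$, $S$ is a uniformly random permutation matrix, and $T$ is a diagonal matrix whose diagonal entries are independent and uniform on $\{1,-1\}$, independent of $S$. 1. There is an absolute constant $C>0$ such that for all such $B$, $D$ and every $v\in\mathbb R^D$ with $\|v\|_2\le 1$, $$\mathbb E_W\Bigl[\bigl\|W^\top\,\mathtt{blkclip}_B(Wv)-v\bigr\|_2^2\Bigr]\le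 C\,\frac{\log^2 D}{B}\qquad\text{and}\qquad \mathbb E_W\Bigl[\bigl\|W^\top\,\mathtt{blkclip}_B(Wv)-v\bigr\|_2^2\Bigr]\le C\,\frac{\log D}{\sqrt B}.$$ 2. Multiplication by $W$ and by $W^\top$ can be performed in time $O(D\log D)$: on a real RAM with unit-cost instructions (addition and truncated subtraction of indices; $+,-,\times,/$ and square root on reals; natural-number constants; array access; comparison of indices) there are two fixed programs and a constant $K$ for each of them such that, for every $D=2^m$, every matrix $W=SHT$, given as $D$ together with the array of the permutation and the array of the signs, and every $x\in\mathbb R^D$, the first program outputs $Wx$ and the second outputs $W^\top x$, in at most $K\,D\log D$ steps if $D\ge 2$ (and after finitely many steps if $D=1$). -/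

import Mathlib

open Matrix

noncomputable section

namespace SHT

/-! ### Block-wise clipping -/

/-- `clip_L(z)`: the vector `z` itself if `‖z‖₂ ≤ L`, and `(L / ‖z‖₂) z` otherwise. -/
def clip {ι : Type*} [Fintype ι] (L : ℝ) (z : EuclideanSpace ℝ ι) : EuclideanSpace ℝ ι :=
  open Classical in if ‖z‖ ≤ L then z else (L / ‖z‖) • z

/-- The `i`-th block `v_i ∈ ℝ^B` of a vector `v ∈ ℝ^D`, `D = Δ B`: its `j`-th coordinate is
coordinate `i B + j` of `v`. -/
def block {Δ B : ℕ} (v : EuclideanSpace ℝ (Fin (Δ * B))) (i : Fin Δ) :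
    EuclideanSpace ℝ (Fin B) :=
  WithLp.toLp 2 fun j => v (finProdFinEquiv (i, j))

/-- The vector of `ℝ^D`, `D = Δ B`, with the given `Δ` consecutive blocks of size `B`. -/
def ofBlocks {Δ B : ℕ} (u : Fin Δ → EuclideanSpace ℝ (Fin B)) :
    EuclideanSpace ℝ (Fin (Δ * B)) :=
  WithLp.toLp 2 fun k => u (finProdFinEquiv.symm k).1 (finProdFinEquiv.symm k).2

/-- `blkclip_B`: every block of size `B` is clipped to Euclidean norm `√(B / D)`, `D = Δ B`. -/
def blkclip {Δ B : ℕ} (v : EuclideanSpace ℝ (Fin (Δ * B))) : EuclideanSpace ℝ (Fin (Δ * B)) :=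
  ofBlocks fun i => clip (Real.sqrt ((B : ℝ) / ((Δ * B : ℕ) : ℝ))) (block v i)

/-! ### The random matrix `W = S H T` -/

/-- The (orthonormal) Hadamard matrix of order `D`, a power of two: the entry at `(i, j)` is
`D^{-1/2} (-1)^{⟨i, j⟩}`, where `⟨i, j⟩` is the number of common ones among the
`log₂ D` binary digits of `i` and `j`. -/
def walshHadamard (D : ℕ) : Matrix (Fin D) (Fin D) ℝ :=
  Matrix.of fun i j =>
    (-1) ^ ((Finset.range (Nat.log 2 D)).filter
      fun k => (i : ℕ).testBit k = true ∧ (j : ℕ).testBit k = true).card / Real.sqrt D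

/-- `W = S H T` with `S` the permutation matrix of `σ` (so `(S x)_i = x_{σ i}`) and `T` the
diagonal matrix of the signs `ε`. -/
def sht {D : ℕ} (σ : Equiv.Perm (Fin D)) (ε : Fin D → ℤˣ) : Matrix (Fin D) (Fin D) ℝ :=
  σ.permMatrix ℝ * walshHadamard D * Matrix.diagonal fun i => (((ε i : ℤˣ) : ℤ) : ℝ)

/-- The joint law of the permutation and of the signs: the permutation is uniform, the signs are
independent and uniform on `{1, -1}`, and permutation and signs are independent; that is, the
pair is uniform on the finite product set. -/
def shtSeed (D : ℕ) : PMF (Equiv.Perm (Fin D) × (Fin D → ℤˣ)) :=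
  PMF.uniformOfFintype _

/-- The expectation `E_W [f W]` over the random matrix `W = S H T` of order `D`. -/
def shtExpectation (D : ℕ) (f : Matrix (Fin D) (Fin D) ℝ → ℝ) : ℝ :=
  ∑ ω : Equiv.Perm (Fin D) × (Fin D → ℤˣ), (shtSeed D ω).toReal * f (sht ω.1 ω.2)

/-- The expected squared error `E_W ‖Wᵀ blkclip_B(W v) - v‖₂²`. -/
def expectedError {Δ B : ℕ} (v : EuclideanSpace ℝ (Fin (Δ * B))) : ℝ :=
  shtExpectation (Δ * B) fun W =>
    ‖Matrix.toEuclideanLin Wᵀ (blkclip (Matrix.toEuclideanLin W v)) - v‖ ^ 2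

/-! ### A unit-cost real RAM with structured control flow -/

/-- The memory: index (natural-number) registers, real registers, and countably many named arrays
of indices and of reals. A program mentions only finitely many registers and array names;
arrays are addressed indirectly, through an index register. -/
structure Mem where
  idx : ℕ → ℕ
  val : ℕ → ℝ
  idxArr : ℕ → ℕ → ℕ
  valArr : ℕ → ℕ → ℝ

/-- Elementary instructions. Natural numbers name registers and arrays, except for the constant
`c`, which is a literal. There is no multiplication of indices, and the only literal
constants are natural numbers. -/
inductive Instr where
  /-- `idx x := c` -/
  | iconst (x c : ℕ)
  /-- `idx x := idx y + idx z` -/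
  | iadd (x y z : ℕ)
  /-- `idx x := idx y - idx z`, truncated at `0` -/
  | isub (x y z : ℕ)
  /-- `idx x := idxArr a [idx y]` -/
  | iload (x a y : ℕ)
  /-- `idxArr a [idx y] := idx x` -/
  | istore (a y x : ℕ)
  /-- `val x := c` -/
  | rconst (x c : ℕ)
  /-- `val x := val y + val z` -/
  | radd (x y z : ℕ)
  /-- `val x := val y - val z` -/
  | rsub (x y z : ℕ)
  /-- `val x := val y * val z` -/
  | rmul (x y z : ℕ)
  /-- `val x := val y / val z` -/
  | rdiv (x y z : ℕ)
  /-- `val x := √(val y)` -/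
  | rsqrt (x y : ℕ)
  /-- `val x := valArr a [idx y]` -/
  | rload (x a y : ℕ)
  /-- `valArr a [idx y] := val x` -/
  | rstore (a y x : ℕ)

/-- The arrays `A` after writing `z` into cell `i` of the array named `a`. -/
def writeArr {α : Type*} (A : ℕ → ℕ → α) (a i : ℕ) (z : α) : ℕ → ℕ → α :=
  Function.update A a (Function.update (A a) i z)

/-- The effect of one instruction on the memory. -/
def Instr.run : Instr → Mem → Mem
  | .iconst x c, s => { s with idx := Function.update s.idx x c }
  | .iadd x y z, s => { s with idx := Function.update s.idx x (s.idx y + s.idx z) }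
  | .isub x y z, s => { s with idx := Function.update s.idx x (s.idx y - s.idx z) }
  | .iload x a y, s => { s with idx := Function.update s.idx x (s.idxArr a (s.idx y)) }
  | .istore a y x, s => { s with idxArr := writeArr s.idxArr a (s.idx y) (s.idx x) }
  | .rconst x c, s => { s with val := Function.update s.val x (c : ℝ) }
  | .radd x y z, s => { s with val := Function.update s.val x (s.val y + s.val z) }
  | .rsub x y z, s => { s with val := Function.update s.val x (s.val y - s.val z) }
  | .rmul x y z, s => { s with val := Function.update s.val x (s.val y * s.val z) }
  | .rdiv x y z, s => { s with val := Function.update s.val x (s.val y / s.val z) }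
  | .rsqrt x y, s => { s with val := Function.update s.val x (Real.sqrt (s.val y)) }
  | .rload x a y, s => { s with val := Function.update s.val x (s.valArr a (s.idx y)) }
  | .rstore a y x, s => { s with valArr := writeArr s.valArr a (s.idx y) (s.val x) }

/-- Programs: finite pieces of code, independent of the input. -/
inductive Prog where
  | instr (a : Instr)
  | seq (p q : Prog)
  /-- `if idx x < idx y then p else q` -/
  | ite (x y : ℕ) (p q : Prog)
  /-- `while idx x < idx y do p` -/
  | while (x y : ℕ) (p : Prog)

/-- `Exec p s t s'`: started in memory `s`, the program `p` halts after exactly `t` steps in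
memory `s'`. Each instruction and each evaluation of a test is one step. -/
inductive Exec : Prog → Mem → ℕ → Mem → Prop
  | instr (a : Instr) (s : Mem) : Exec (.instr a) s 1 (a.run s)
  | seq {p q : Prog} {s₁ s₂ s₃ : Mem} {t₁ t₂ : ℕ} :
      Exec p s₁ t₁ s₂ → Exec q s₂ t₂ s₃ → Exec (.seq p q) s₁ (t₁ + t₂) s₃
  | ite_true {x y : ℕ} {p q : Prog} {s s' : Mem} {t : ℕ} :
      s.idx x < s.idx y → Exec p s t s' → Exec (.ite x y p q) s (t + 1) s'
  | ite_false {x y : ℕ} {p q : Prog} {s s' : Mem} {t : ℕ} :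
      ¬ s.idx x < s.idx y → Exec q s t s' → Exec (.ite x y p q) s (t + 1) s'
  | while_true {x y : ℕ} {p : Prog} {s₁ s₂ s₃ : Mem} {t₁ t₂ : ℕ} :
      s₁.idx x < s₁.idx y → Exec p s₁ t₁ s₂ → Exec (.while x y p) s₂ t₂ s₃ →
        Exec (.while x y p) s₁ (t₁ + t₂ + 1) s₃
  | while_false {x y : ℕ} {p : Prog} {s : Mem} :
      ¬ s.idx x < s.idx y → Exec (.while x y p) s 1 s

/-- The memory `s` holds the input `(D, σ, ε, x)`: index register `0` holds `D`, index array `0`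
the permutation, real array `0` the vector and real array `1` the signs. All the other
contents of the memory are arbitrary. -/
def IsInput {D : ℕ} (σ : Equiv.Perm (Fin D)) (ε : Fin D → ℤˣ) (x : Fin D → ℝ) (s : Mem) : Prop :=
  s.idx 0 = D ∧ ∀ i : Fin D,
    s.idxArr 0 i = (σ i : ℕ) ∧ s.valArr 0 i = x i ∧ s.valArr 1 i = (((ε i : ℤˣ) : ℤ) : ℝ)

/-- The program `p` multiplies by `f W`, for every matrix `W = S H T` of every order `D = 2^m` (given
through its permutation and its signs) and every real vector, leaving the product in real array
`2`, within `K D log D` steps if `D ≥ 2` (for `D = 1` the bound would read `0`). -/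
def MultipliesWithin (f : ∀ {D : ℕ}, Matrix (Fin D) (Fin D) ℝ → Matrix (Fin D) (Fin D) ℝ)
    (p : Prog) (K : ℝ) : Prop :=
  ∀ (m D : ℕ), D = 2 ^ m →
    ∀ (σ : Equiv.Perm (Fin D)) (ε : Fin D → ℤˣ) (x : Fin D → ℝ) (s : Mem), IsInput σ ε x s →
      ∃ (t : ℕ) (s' : Mem), Exec p s t s' ∧
        (∀ i : Fin D, s'.valArr 2 i = (f (sht σ ε) *ᵥ x) i) ∧
        (2 ≤ D → (t : ℝ) ≤ K * (D * Real.log D))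

end SHT

end

/-!
The permutation makes a block of `W v` a sample without replacement from the coordinates of
`z = H T v`. The squared entries at two positions are negatively correlated, so the squared norm of
the block deviates from its mean `‖v‖² / Δ ≤ B / D` by a variance of at most
`(∑ zₖ⁴ - ‖v‖⁴ / D) / Δ`. Clipping moves a block only if its squared norm exceeds `B / D`, and then
by at most `√(D / B)` times this deviation. The random signs give
`𝔼 zₖ⁴ = (3 ‖v‖⁴ - 2 ∑ vⱼ⁴) / D²`, so the expected squared error is at most
`2 (‖v‖⁴ - ∑ vⱼ⁴) / B ≤ 2 (1 - 1 / D) / B ≤ 2 log D / B`, which for powers of two `D` implies both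
bounds. As `W` is orthogonal, `Wᵀ` does not change the error.

The transform `x ↦ H x` is the `log₂ D`-fold iterate of one stage that costs `O(D)` steps: write the
normalized sums and differences of neighbouring entries to the lower and to the upper half. The
digit of the position that a stage removes at the low end reappears, transformed, at the high end.
-/

namespace SHT

open scoped BigOperators

/-! ### Uniform permutations and uniform signs -/

theorem expect_sub_expect_sq {ι 𝕜 : Type*} [Fintype ι] [Nonempty ι] [Field 𝕜] [CharZero 𝕜]
    (w : ι → 𝕜) :
    𝔼 j, (w j - 𝔼 k, w k) ^ 2 = 𝔼 j, w j ^ 2 - (𝔼 j, w j) ^ 2 := by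
  simp only [sub_sq, Finset.expect_add_distrib, Finset.expect_sub_distrib, ← Finset.mul_expect,
    ← Finset.expect_mul, Fintype.expect_const]
  ring

section UniformPermutation

variable {ι κ 𝕜 : Type*} [Fintype ι] [DecidableEq ι] [Fintype κ]
  [Field 𝕜] [LinearOrder 𝕜] [IsStrictOrderedRing 𝕜]

theorem expect_perm_apply {M : Type*} [AddCommMonoid M] [Module ℚ≥0 M] (w : ι → M) (k : ι) :
    𝔼 σ : Equiv.Perm ι, w (σ k) = 𝔼 j, w j := by
  have : Nonempty ι := ⟨k⟩
  have hk (l : ι) : 𝔼 σ : Equiv.Perm ι, w (σ l) = 𝔼 σ : Equiv.Perm ι, w (σ k) :=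
    Fintype.expect_equiv (Equiv.mulRight (Equiv.swap l k)) _ _ fun σ => by simp
  calc 𝔼 σ : Equiv.Perm ι, w (σ k)
      = 𝔼 l, 𝔼 σ : Equiv.Perm ι, w (σ l) := by simp only [hk, Fintype.expect_const]
    _ = 𝔼 σ : Equiv.Perm ι, 𝔼 l, w (σ l) := Finset.expect_comm ..
    _ = 𝔼 _σ : Equiv.Perm ι, 𝔼 j, w j :=
      Finset.expect_congr rfl fun σ _ => Fintype.expect_equiv σ _ _ fun _ => rfl
    _ = 𝔼 j, w j := Fintype.expect_const _

/-- Summing over all positions `l ≠ k` gives `-w (σ k) ^ 2`, and all these `l` contribute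
equally. -/
theorem expect_perm_mul_nonpos {w : ι → 𝕜} (hw : ∑ j, w j = 0) {k l : ι} (hkl : k ≠ l) :
    𝔼 σ : Equiv.Perm ι, w (σ k) * w (σ l) ≤ 0 := by
  have hswap : ∀ j ∈ Finset.univ.erase k,
      𝔼 σ : Equiv.Perm ι, w (σ k) * w (σ j) = 𝔼 σ : Equiv.Perm ι, w (σ k) * w (σ l) :=
    fun j hj => Fintype.expect_equiv (Equiv.mulRight (Equiv.swap j l)) _ _ fun σ => by
      simp [Equiv.swap_apply_of_ne_of_ne (Finset.ne_of_mem_erase hj).symm hkl]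
  have hothers (σ : Equiv.Perm ι) : ∑ j ∈ Finset.univ.erase k, w (σ j) = -w (σ k) := by
    rw [eq_neg_iff_add_eq_zero, Finset.sum_erase_add _ _ (Finset.mem_univ k),
      Equiv.sum_comp σ w, hw]
  have hcard : 0 < ((Finset.univ.erase k).card : 𝕜) :=
    Nat.cast_pos.2 (Finset.card_pos.2 ⟨l, Finset.mem_erase.2 ⟨hkl.symm, Finset.mem_univ l⟩⟩)
  refine nonpos_of_mul_nonpos_right (a := ((Finset.univ.erase k).card : 𝕜)) ?_ hcard
  calc ((Finset.univ.erase k).card : 𝕜) * 𝔼 σ : Equiv.Perm ι, w (σ k) * w (σ l)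
      = ∑ j ∈ Finset.univ.erase k, 𝔼 σ : Equiv.Perm ι, w (σ k) * w (σ j) := by
        rw [Finset.sum_congr rfl hswap, Finset.sum_const, nsmul_eq_mul]
    _ = 𝔼 σ : Equiv.Perm ι, ∑ j ∈ Finset.univ.erase k, w (σ k) * w (σ j) :=
        (Finset.expect_sum_comm ..).symm
    _ = 𝔼 σ : Equiv.Perm ι, -(w (σ k) * w (σ k)) := by
        simp only [← Finset.mul_sum, hothers, mul_neg]
    _ = -𝔼 σ : Equiv.Perm ι, w (σ k) * w (σ k) := Finset.expect_neg_distrib ..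
    _ ≤ 0 := neg_nonpos.2 (Finset.expect_nonneg fun σ _ => mul_self_nonneg _)

theorem expect_perm_sum_sq_le {w : ι → 𝕜} (hw : ∑ j, w j = 0) (f : κ ↪ ι) :
    𝔼 σ : Equiv.Perm ι, (∑ k, w (σ (f k))) ^ 2 ≤ Fintype.card κ * 𝔼 j, w j ^ 2 := by
  classical
  calc 𝔼 σ : Equiv.Perm ι, (∑ k, w (σ (f k))) ^ 2
      = ∑ k, ∑ l, 𝔼 σ : Equiv.Perm ι, w (σ (f k)) * w (σ (f l)) := by
        simp only [sq, Finset.sum_mul_sum, Finset.expect_sum_comm]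
    _ ≤ ∑ k, 𝔼 σ : Equiv.Perm ι, w (σ (f k)) ^ 2 := Finset.sum_le_sum fun k _ => by
        rw [← Finset.add_sum_erase _ _ (Finset.mem_univ k)]
        simp only [← sq]
        exact add_le_of_nonpos_right (Finset.sum_nonpos fun l hl =>
          expect_perm_mul_nonpos hw (f.injective.ne (Finset.ne_of_mem_erase hl).symm))
    _ = Fintype.card κ * 𝔼 j, w j ^ 2 := by
        simp only [expect_perm_apply (fun j => w j ^ 2), Finset.sum_const, Finset.card_univ,
          nsmul_eq_mul]

theorem expect_perm_sum_sub_sq_le [Nonempty ι] (w : ι → 𝕜) (f : κ ↪ ι) :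
    𝔼 σ : Equiv.Perm ι, (∑ k, w (σ (f k)) - Fintype.card κ * 𝔼 j, w j) ^ 2 ≤
      Fintype.card κ * (𝔼 j, w j ^ 2 - (𝔼 j, w j) ^ 2) := by
  have hcentred : ∑ j, (w j - 𝔼 k, w k) = 0 := by
    rw [Finset.sum_sub_distrib, Finset.sum_const, Finset.card_univ, nsmul_eq_mul,
      Fintype.card_mul_expect, sub_self]
  rw [← expect_sub_expect_sq]
  simpa only [Finset.sum_sub_distrib, Finset.sum_const, Finset.card_univ, nsmul_eq_mul]
    using expect_perm_sum_sq_le hcentred f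

end UniformPermutation

section UniformSigns

variable {ι 𝕜 : Type*} [Fintype ι] [DecidableEq ι] [Field 𝕜] [CharZero 𝕜]

theorem expect_signs_insert {s : Finset ι} {k : ι} (hk : k ∉ s) (a : ι → 𝕜) (g : 𝕜 → 𝕜) :
    𝔼 ε : ι → ℤˣ, g (∑ i ∈ insert k s, ((ε i : ℤ) : 𝕜) * a i) =
      𝔼 ε : ι → ℤˣ, (g (a k + ∑ i ∈ s, ((ε i : ℤ) : 𝕜) * a i) +
        g (-a k + ∑ i ∈ s, ((ε i : ℤ) : 𝕜) * a i)) / 2 := by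
  let F (u : ℤˣ) (ε : ι → ℤˣ) : 𝕜 := g (((u : ℤ) : 𝕜) * a k + ∑ i ∈ s, ((ε i : ℤ) : 𝕜) * a i)
  let flip : ι → ℤˣ := Pi.mulSingle k (-1)
  have hflip_self (ε : ι → ℤˣ) : (ε * flip) k = -ε k := by simp [flip]
  have hflip_sum (ε : ι → ℤˣ) :
      ∑ i ∈ s, (((ε * flip) i : ℤ) : 𝕜) * a i = ∑ i ∈ s, ((ε i : ℤ) : 𝕜) * a i :=
    Finset.sum_congr rfl fun i hi => by
      simp [flip, Pi.mulSingle_eq_of_ne (ne_of_mem_of_not_mem hi hk)]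
  have hflip : 𝔼 ε : ι → ℤˣ, F (ε k) ε = 𝔼 ε : ι → ℤˣ, F (-ε k) ε :=
    Fintype.expect_equiv (Equiv.mulRight flip) _ _ fun ε => by
      simp only [F, Equiv.coe_mulRight, hflip_self, hflip_sum, neg_neg]
  have hpair (ε : ι → ℤˣ) : F (ε k) ε + F (-ε k) ε = F 1 ε + F (-1) ε := by
    rcases Int.units_eq_one_or (ε k) with h | h <;> simp only [h, neg_neg, add_comm]
  calc 𝔼 ε : ι → ℤˣ, g (∑ i ∈ insert k s, ((ε i : ℤ) : 𝕜) * a i)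
      = 𝔼 ε : ι → ℤˣ, F (ε k) ε := by simp only [F, Finset.sum_insert hk]
    _ = (𝔼 ε : ι → ℤˣ, F (ε k) ε + 𝔼 ε : ι → ℤˣ, F (-ε k) ε) / 2 := by rw [← hflip]; ring
    _ = 𝔼 ε : ι → ℤˣ, (F 1 ε + F (-1) ε) / 2 := by
      simp only [← Finset.expect_add_distrib, hpair, Finset.expect_div]
    _ = _ := by simp [F]

theorem expect_signs_sum_sq (s : Finset ι) (a : ι → 𝕜) :
    𝔼 ε : ι → ℤˣ, (∑ i ∈ s, ((ε i : ℤ) : 𝕜) * a i) ^ 2 = ∑ i ∈ s, a i ^ 2 := by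
  induction s using Finset.induction_on with
  | empty => simp
  | insert k s hk ih =>
    have hparallelogram (S : 𝕜) : ((a k + S) ^ 2 + (-a k + S) ^ 2) / 2 = a k ^ 2 + S ^ 2 := by ring
    rw [expect_signs_insert hk a (· ^ 2)]
    simp only [hparallelogram, Finset.expect_add_distrib, ih, Fintype.expect_const,
      Finset.sum_insert hk]

theorem expect_signs_sum_pow_four (s : Finset ι) (a : ι → 𝕜) :
    𝔼 ε : ι → ℤˣ, (∑ i ∈ s, ((ε i : ℤ) : 𝕜) * a i) ^ 4 =
      3 * (∑ i ∈ s, a i ^ 2) ^ 2 - 2 * ∑ i ∈ s, a i ^ 4 := by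
  induction s using Finset.induction_on with
  | empty => simp
  | insert k s hk ih =>
    have heven (S : 𝕜) : ((a k + S) ^ 4 + (-a k + S) ^ 4) / 2 =
        a k ^ 4 + 6 * a k ^ 2 * S ^ 2 + S ^ 4 := by ring
    rw [expect_signs_insert hk a (· ^ 4)]
    simp only [heven, Finset.expect_add_distrib, ← Finset.mul_expect, expect_signs_sum_sq, ih,
      Fintype.expect_const, Finset.sum_insert hk]
    ring

end UniformSigns

/-! ### Block-wise clipping -/

theorem norm_clip_sub {ι : Type*} [Fintype ι] {L : ℝ} {z : EuclideanSpace ℝ ι} (hL : 0 ≤ L)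
    (hz : L < ‖z‖) : ‖clip L z - z‖ = ‖z‖ - L := by
  have hz0 : 0 < ‖z‖ := hL.trans_lt hz
  have hsub : clip L z - z = -((1 - L / ‖z‖) • z) := by
    rw [clip, if_neg hz.not_ge]
    module
  rw [hsub, norm_neg, norm_smul,
    Real.norm_of_nonneg (sub_nonneg.2 ((div_le_one hz0).2 hz.le)), sub_mul, one_mul,
    div_mul_cancel₀ _ hz0.ne']

theorem mul_norm_clip_sub_le {ι : Type*} [Fintype ι] {L c : ℝ} (hL : 0 ≤ L) (hc : c ≤ L ^ 2)
    (z : EuclideanSpace ℝ ι) : L * ‖clip L z - z‖ ≤ |‖z‖ ^ 2 - c| := by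
  rcases le_or_gt ‖z‖ L with hz | hz
  · simp [clip, hz]
  · rw [norm_clip_sub hL hz]
    refine le_trans ?_ (le_abs_self _)
    nlinarith [mul_nonneg (norm_nonneg z) (sub_nonneg.2 hz.le)]

section Blocks

variable {Δ B : ℕ}

theorem norm_sq_eq_sum_block (v : EuclideanSpace ℝ (Fin (Δ * B))) :
    ‖v‖ ^ 2 = ∑ i, ‖block v i‖ ^ 2 := by
  simp only [EuclideanSpace.norm_sq_eq, block]
  rw [← finProdFinEquiv.sum_comp, Fintype.sum_prod_type]

theorem block_blkclip_sub (y : EuclideanSpace ℝ (Fin (Δ * B))) (i : Fin Δ) :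
    block (blkclip y - y) i =
      clip (√((B : ℝ) / ((Δ * B : ℕ) : ℝ))) (block y i) - block y i := by
  ext j
  simp only [block, blkclip, ofBlocks, PiLp.sub_apply, Equiv.symm_apply_apply]

theorem norm_blkclip_sub_sq_le (hB : 0 < B) {y : EuclideanSpace ℝ (Fin (Δ * B))} (hy : ‖y‖ ≤ 1) :
    ‖blkclip y - y‖ ^ 2 ≤ Δ * ∑ i, (‖block y i‖ ^ 2 - ‖y‖ ^ 2 / Δ) ^ 2 := by
  rw [norm_sq_eq_sum_block, Finset.mul_sum]
  refine Finset.sum_le_sum fun i _ => ?_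
  have hΔ : (0 : ℝ) < Δ := Nat.cast_pos.2 i.pos
  have hB' : (B : ℝ) ≠ 0 := Nat.cast_ne_zero.2 hB.ne'
  have hthreshold : (B : ℝ) / ((Δ * B : ℕ) : ℝ) = 1 / Δ := by push_cast; field_simp
  have hmean : ‖y‖ ^ 2 / Δ ≤ √(1 / Δ) ^ 2 := by
    rw [Real.sq_sqrt (by positivity)]
    gcongr
    exact pow_le_one₀ (norm_nonneg y) hy
  have hclip := pow_le_pow_left₀ (by positivity)
    (mul_norm_clip_sub_le (Real.sqrt_nonneg _) hmean (block y i)) 2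
  rwa [mul_pow, Real.sq_sqrt (by positivity), sq_abs, one_div_mul_eq_div, div_le_iff₀' hΔ,
    ← hthreshold, ← block_blkclip_sub] at hclip

theorem expect_perm_norm_block_sq_sub_sq_le (hB : 0 < B) (z : EuclideanSpace ℝ (Fin (Δ * B)))
    (i : Fin Δ) :
    𝔼 σ : Equiv.Perm (Fin (Δ * B)), (‖block (WithLp.toLp 2 (z ∘ σ)) i‖ ^ 2 - ‖z‖ ^ 2 / Δ) ^ 2 ≤
      (∑ k, z k ^ 4 - ‖z‖ ^ 4 / (Δ * B : ℕ)) / Δ := by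
  have : Nonempty (Fin (Δ * B)) := ⟨⟨0, Nat.mul_pos i.pos hB⟩⟩
  have hΔ : (Δ : ℝ) ≠ 0 := Nat.cast_ne_zero.2 i.pos.ne'
  have hB' : (B : ℝ) ≠ 0 := Nat.cast_ne_zero.2 hB.ne'
  let f : Fin B ↪ Fin (Δ * B) :=
    (Function.Embedding.sectR i (Fin B)).trans finProdFinEquiv.toEmbedding
  have hblock (σ : Equiv.Perm (Fin (Δ * B))) :
      ‖block (WithLp.toLp 2 (z ∘ σ)) i‖ ^ 2 = ∑ j, z (σ (f j)) ^ 2 :=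
    EuclideanSpace.real_norm_sq_eq _
  have hmean : 𝔼 k, z k ^ 2 = ‖z‖ ^ 2 / (Δ * B : ℕ) := by
    rw [Fintype.expect_eq_sum_div_card, ← EuclideanSpace.real_norm_sq_eq, Fintype.card_fin]
  have hcentre : B * (‖z‖ ^ 2 / (Δ * B : ℕ)) = ‖z‖ ^ 2 / Δ := by push_cast; field_simp
  have hvariance := expect_perm_sum_sub_sq_le (fun k => z k ^ 2) f
  simp only [hmean, Fintype.card_fin, hcentre, ← hblock] at hvariance
  refine hvariance.trans_eq ?_
  rw [Fintype.expect_eq_sum_div_card, Fintype.card_fin]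
  simp only [← pow_mul]
  push_cast
  field_simp

theorem expect_perm_norm_blkclip_sub_sq_le (hΔ : 0 < Δ) (hB : 0 < B)
    {z : EuclideanSpace ℝ (Fin (Δ * B))} (hz : ‖z‖ ≤ 1) :
    𝔼 σ : Equiv.Perm (Fin (Δ * B)), ‖blkclip (WithLp.toLp 2 (z ∘ σ)) - WithLp.toLp 2 (z ∘ σ)‖ ^ 2 ≤
      Δ * (∑ k, z k ^ 4 - ‖z‖ ^ 4 / (Δ * B : ℕ)) := by
  have hΔ' : (Δ : ℝ) ≠ 0 := Nat.cast_ne_zero.2 hΔ.ne'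
  have hnorm (σ : Equiv.Perm (Fin (Δ * B))) : ‖WithLp.toLp 2 (z ∘ σ)‖ = ‖z‖ :=
    (LinearIsometryEquiv.piLpCongrLeft 2 ℝ ℝ σ.symm).norm_map z
  calc 𝔼 σ : Equiv.Perm (Fin (Δ * B)),
        ‖blkclip (WithLp.toLp 2 (z ∘ σ)) - WithLp.toLp 2 (z ∘ σ)‖ ^ 2
      ≤ 𝔼 σ : Equiv.Perm (Fin (Δ * B)),
          Δ * ∑ i, (‖block (WithLp.toLp 2 (z ∘ σ)) i‖ ^ 2 - ‖z‖ ^ 2 / Δ) ^ 2 :=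
        Finset.expect_le_expect fun σ _ => by
          have := norm_blkclip_sub_sq_le hB (hnorm σ ▸ hz)
          rwa [hnorm σ] at this
    _ = Δ * ∑ i, 𝔼 σ : Equiv.Perm (Fin (Δ * B)),
          (‖block (WithLp.toLp 2 (z ∘ σ)) i‖ ^ 2 - ‖z‖ ^ 2 / Δ) ^ 2 := by
        rw [← Finset.mul_expect, Finset.expect_sum_comm]
    _ ≤ Δ * ∑ _i : Fin Δ, (∑ k, z k ^ 4 - ‖z‖ ^ 4 / (Δ * B : ℕ)) / Δ := by
        gcongr with i
        exact expect_perm_norm_block_sq_sub_sq_le hB z i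
    _ = Δ * (∑ k, z k ^ 4 - ‖z‖ ^ 4 / (Δ * B : ℕ)) := by
        rw [Finset.sum_const, Finset.card_univ, Fintype.card_fin, nsmul_eq_mul]
        field_simp

end Blocks

/-! ### The Walsh–Hadamard matrix -/

/-- The sign `(-1) ^ ⟨i, j⟩`, where `⟨i, j⟩` is the inner product of the `m` lowest binary digits
of `i` and `j`: the entries of the unnormalized Walsh–Hadamard matrix, indexed by natural numbers
so that the digits can be split off one at a time. -/
noncomputable def walshSign (m i j : ℕ) : ℝ :=
  (-1) ^ ((Finset.range m).filter fun k => i.testBit k = true ∧ j.testBit k = true).card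

@[simp] theorem walshSign_zero (i j : ℕ) : walshSign 0 i j = 1 := by simp [walshSign]

theorem walshSign_succ (m i j : ℕ) :
    walshSign (m + 1) i j =
      walshSign m i j * if i.testBit m = true ∧ j.testBit m = true then -1 else 1 := by
  unfold walshSign
  rw [Finset.range_add_one, Finset.filter_insert]
  split_ifs
  · rw [Finset.card_insert_of_notMem (by simp), pow_succ]
  · rw [mul_one]

theorem walshSign_comm (m i j : ℕ) : walshSign m i j = walshSign m j i := by
  simp only [walshSign, and_comm]

theorem walshSign_congr {m i i' j j' : ℕ} (hi : ∀ k < m, i.testBit k = i'.testBit k)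
    (hj : ∀ k < m, j.testBit k = j'.testBit k) : walshSign m i j = walshSign m i' j' := by
  unfold walshSign
  congr 2
  refine Finset.filter_congr fun k hk => ?_
  rw [hi k (Finset.mem_range.1 hk), hj k (Finset.mem_range.1 hk)]

theorem walshSign_two_pow_mul_add {m i j : ℕ} (a c : ℕ) (hi : i < 2 ^ m) (hj : j < 2 ^ m) :
    walshSign (m + 1) (2 ^ m * a + i) (2 ^ m * c + j) =
      walshSign m i j * if a.testBit 0 = true ∧ c.testBit 0 = true then -1 else 1 := by
  have hlow {b l : ℕ} (hl : l < 2 ^ m) : ∀ k < m, (2 ^ m * b + l).testBit k = l.testBit k :=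
    fun k hk => by rw [Nat.testBit_two_pow_mul_add _ hl, if_pos hk]
  rw [walshSign_succ, Nat.testBit_two_pow_mul_add _ hi, Nat.testBit_two_pow_mul_add _ hj,
    walshSign_congr (hlow hi) (hlow hj)]
  simp only [lt_irrefl, if_false, Nat.sub_self]

theorem sum_range_two_pow_succ {M : Type*} [AddCommMonoid M] (m : ℕ) (f : ℕ → M) :
    ∑ j ∈ Finset.range (2 ^ (m + 1)), f j =
      ∑ j ∈ Finset.range (2 ^ m), (f j + f (2 ^ m * 1 + j)) := by
  rw [pow_succ, mul_two, Finset.sum_range_add, mul_one, Finset.sum_add_distrib]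

theorem sum_walshSign_mul_walshSign (m i i' : ℕ) :
    ∑ j ∈ Finset.range (2 ^ m), walshSign m i j * walshSign m i' j =
      ∏ k ∈ Finset.range m, if i.testBit k = i'.testBit k then (2 : ℝ) else 0 := by
  induction m with
  | zero => simp
  | succ m ih =>
    rw [sum_range_two_pow_succ, Finset.prod_range_succ, ← ih, Finset.sum_mul]
    refine Finset.sum_congr rfl fun j hj => ?_
    have hj := Finset.mem_range.1 hj
    have hlow : j.testBit m = false := Nat.testBit_lt_two_pow hj
    have hhigh : (2 ^ m * 1 + j).testBit m = true := by
      rw [Nat.testBit_two_pow_mul_add _ hj, if_neg (lt_irrefl m), Nat.sub_self,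
        Nat.testBit_one_zero]
    have hsign (i : ℕ) : walshSign m i (2 ^ m * 1 + j) = walshSign m i j :=
      walshSign_congr (fun _ _ => rfl) fun k hk => by
        rw [Nat.testBit_two_pow_mul_add _ hj, if_pos hk]
    simp only [walshSign_succ, hlow, hhigh, hsign]
    cases i.testBit m <;> cases i'.testBit m <;> simp <;> ring

theorem sum_walshSign_mul_walshSign_eq {m i i' : ℕ} (hi : i < 2 ^ m) (hi' : i' < 2 ^ m) :
    ∑ j ∈ Finset.range (2 ^ m), walshSign m i j * walshSign m i' j =
      if i = i' then ((2 ^ m : ℕ) : ℝ) else 0 := by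
  rw [sum_walshSign_mul_walshSign]
  split_ifs with h
  · simp [h]
  · obtain ⟨k, hk⟩ := Nat.exists_testBit_ne_of_ne h
    have hkm : k < m := by
      by_contra hkm
      have hle : 2 ^ m ≤ 2 ^ k := Nat.pow_le_pow_right two_pos (not_lt.1 hkm)
      exact hk (by rw [Nat.testBit_lt_two_pow (hi.trans_le hle),
        Nat.testBit_lt_two_pow (hi'.trans_le hle)])
    exact Finset.prod_eq_zero (Finset.mem_range.2 hkm) (if_neg hk)

section WalshHadamard

variable {m D : ℕ}

theorem walshHadamard_transpose (D : ℕ) : (walshHadamard D)ᵀ = walshHadamard D := by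
  ext i j
  simp only [walshHadamard, Matrix.transpose_apply, Matrix.of_apply, and_comm]

theorem walshHadamard_sq (i j : Fin D) : walshHadamard D i j ^ 2 = 1 / D := by
  rw [walshHadamard, Matrix.of_apply, div_pow, ← pow_mul, pow_mul', neg_one_sq, one_pow,
    Real.sq_sqrt D.cast_nonneg]

theorem walshHadamard_apply (hD : D = 2 ^ m) (i j : Fin D) :
    walshHadamard D i j = walshSign m i j / √D := by
  have hlog : Nat.log 2 D = m := by rw [hD, Nat.log_pow one_lt_two]
  rw [walshHadamard, Matrix.of_apply, walshSign, hlog]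

theorem walshHadamard_mem_orthogonalGroup (hD : D = 2 ^ m) :
    walshHadamard D ∈ Matrix.orthogonalGroup (Fin D) ℝ := by
  rw [Matrix.mem_orthogonalGroup_iff, walshHadamard_transpose]
  ext i j
  have hD0 : (D : ℝ) ≠ 0 := by rw [hD]; positivity
  have hentry (k : Fin D) : walshHadamard D i k * walshHadamard D k j =
      walshSign m i k * walshSign m j k / D := by
    rw [walshHadamard_apply hD, walshHadamard_apply hD, walshSign_comm m k j, div_mul_div_comm,
      Real.mul_self_sqrt D.cast_nonneg]
  have hsum : ∑ k : Fin D, walshSign m i k * walshSign m j k = if i = j then (D : ℝ) else 0 := by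
    rw [Fin.sum_univ_eq_sum_range (fun k => walshSign m i k * walshSign m j k)]
    simpa only [← hD, Fin.ext_iff] using
      sum_walshSign_mul_walshSign_eq (i.2.trans_eq hD) (j.2.trans_eq hD)
  rw [Matrix.mul_apply, Finset.sum_congr rfl fun k _ => hentry k, ← Finset.sum_div, hsum,
    Matrix.one_apply, ite_div, div_self hD0, zero_div]

theorem walshHadamard_mulVec (hD : D = 2 ^ m) (x : ℕ → ℝ) (i : Fin D) :
    (walshHadamard D *ᵥ fun j => x j) i =
      (∑ j ∈ Finset.range (2 ^ m), walshSign m i j * x j) / √D := by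
  simp only [Matrix.mulVec, dotProduct, walshHadamard_apply hD, div_mul_eq_mul_div]
  rw [← Finset.sum_div, Fin.sum_univ_eq_sum_range (fun j => walshSign m i j * x j), ← hD]

end WalshHadamard

/-! ### The matrix `S H T` -/

theorem permMatrix_mem_orthogonalGroup {ι R : Type*} [Fintype ι] [DecidableEq ι] [CommRing R]
    (σ : Equiv.Perm ι) : σ.permMatrix R ∈ Matrix.orthogonalGroup ι R := by
  rw [Matrix.mem_orthogonalGroup_iff, Matrix.transpose_permMatrix, ← Matrix.permMatrix_mul,
    inv_mul_cancel, Matrix.permMatrix_one]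

theorem diagonal_signs_mem_orthogonalGroup {ι R : Type*} [Fintype ι] [DecidableEq ι] [CommRing R]
    (ε : ι → ℤˣ) : Matrix.diagonal (fun i => ((ε i : ℤ) : R)) ∈ Matrix.orthogonalGroup ι R := by
  rw [Matrix.mem_orthogonalGroup_iff, Matrix.diagonal_transpose, Matrix.diagonal_mul_diagonal]
  simp [← Int.cast_mul, ← Units.val_mul]

theorem norm_toEuclideanLin_of_mem_orthogonalGroup {ι : Type*} [Fintype ι] [DecidableEq ι]
    {U : Matrix ι ι ℝ} (hU : U ∈ Matrix.orthogonalGroup ι ℝ) (v : EuclideanSpace ℝ ι) :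
    ‖Matrix.toEuclideanLin U v‖ = ‖v‖ :=
  ContinuousLinearMap.norm_map_of_mem_unitary
    (Unitary.map_mem (Matrix.toEuclideanCLM (n := ι) (𝕜 := ℝ)) hU) v

theorem norm_toEuclideanLin_transpose_sub {ι : Type*} [Fintype ι] [DecidableEq ι]
    {U : Matrix ι ι ℝ} (hU : U ∈ Matrix.orthogonalGroup ι ℝ) (y v : EuclideanSpace ℝ ι) :
    ‖Matrix.toEuclideanLin Uᵀ y - v‖ = ‖y - Matrix.toEuclideanLin U v‖ := by
  have hUU : U * Uᵀ = 1 := (Matrix.mem_orthogonalGroup_iff ι ℝ).1 hU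
  have hcancel : Matrix.toEuclideanLin U (Matrix.toEuclideanLin Uᵀ y) = y := by
    simp only [Matrix.toLpLin_apply, Matrix.mulVec_mulVec, hUU, Matrix.one_mulVec]
  rw [← norm_toEuclideanLin_of_mem_orthogonalGroup hU, map_sub, hcancel]

section SignedHadamard

variable {m D : ℕ} (σ : Equiv.Perm (Fin D)) (ε : Fin D → ℤˣ)

theorem sht_mem_orthogonalGroup (hD : D = 2 ^ m) : sht σ ε ∈ Matrix.orthogonalGroup (Fin D) ℝ :=
  mul_mem (mul_mem (permMatrix_mem_orthogonalGroup σ) (walshHadamard_mem_orthogonalGroup hD))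
    (diagonal_signs_mem_orthogonalGroup ε)

theorem sht_mulVec (x : Fin D → ℝ) :
    sht σ ε *ᵥ x = (walshHadamard D *ᵥ fun j => ((ε j : ℤ) : ℝ) * x j) ∘ σ := by
  rw [sht, ← Matrix.mulVec_mulVec, ← Matrix.mulVec_mulVec, Matrix.permMatrix_mulVec]
  simp only [funext (Matrix.mulVec_diagonal _ x)]

theorem sht_transpose_mulVec (x : Fin D → ℝ) :
    (sht σ ε)ᵀ *ᵥ x = fun i => ((ε i : ℤ) : ℝ) * (walshHadamard D *ᵥ (x ∘ σ.symm)) i := by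
  ext i
  rw [sht, Matrix.transpose_mul, Matrix.transpose_mul, walshHadamard_transpose,
    Matrix.diagonal_transpose, Matrix.transpose_permMatrix, ← Matrix.mulVec_mulVec,
    ← Matrix.mulVec_mulVec, Matrix.mulVec_diagonal, Matrix.permMatrix_mulVec]
  rfl

/-! ### The expected squared error -/

theorem shtExpectation_eq_expect (f : Matrix (Fin D) (Fin D) ℝ → ℝ) :
    shtExpectation D f = 𝔼 ε : Fin D → ℤˣ, 𝔼 σ : Equiv.Perm (Fin D), f (sht σ ε) := by
  simp only [shtExpectation, shtSeed, PMF.uniformOfFintype_apply, Fintype.expect_eq_sum_div_card,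
    ← Finset.sum_div, ← Finset.mul_sum, Fintype.sum_prod_type_right, Fintype.card_prod,
    Nat.cast_mul, ENNReal.toReal_inv, ENNReal.toReal_mul, ENNReal.toReal_natCast]
  rw [div_div, inv_mul_eq_div]

theorem expect_signs_walshHadamard_pow_four (v : Fin D → ℝ) (i : Fin D) :
    𝔼 ε : Fin D → ℤˣ, (walshHadamard D *ᵥ fun j => ((ε j : ℤ) : ℝ) * v j) i ^ 4 =
      (3 * (∑ j, v j ^ 2) ^ 2 - 2 * ∑ j, v j ^ 4) / D ^ 2 := by
  have hfour (j : Fin D) : walshHadamard D i j ^ 4 = 1 / (D : ℝ) ^ 2 := by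
    rw [show 4 = 2 * 2 from rfl, pow_mul, walshHadamard_sq, div_pow, one_pow]
  simp only [Matrix.mulVec, dotProduct, mul_left_comm (walshHadamard D i _),
    expect_signs_sum_pow_four, mul_pow, walshHadamard_sq, hfour, ← Finset.mul_sum]
  ring

theorem norm_walshHadamard_signs (hD : D = 2 ^ m) (v : EuclideanSpace ℝ (Fin D)) :
    ‖WithLp.toLp 2 (walshHadamard D *ᵥ fun j => ((ε j : ℤ) : ℝ) * v j)‖ = ‖v‖ := by
  have h := norm_toEuclideanLin_of_mem_orthogonalGroup (sht_mem_orthogonalGroup 1 ε hD) v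
  rwa [Matrix.toLpLin_apply, sht_mulVec] at h

end SignedHadamard

theorem expect_perm_norm_transpose_blkclip_sub_sq_le {m Δ B : ℕ} (h : Δ * B = 2 ^ m)
    (ε : Fin (Δ * B) → ℤˣ) {v : EuclideanSpace ℝ (Fin (Δ * B))} (hv : ‖v‖ ≤ 1) :
    𝔼 σ, ‖Matrix.toEuclideanLin (sht σ ε)ᵀ
        (blkclip (Matrix.toEuclideanLin (sht σ ε) v)) - v‖ ^ 2 ≤
      Δ * (∑ k, (walshHadamard (Δ * B) *ᵥ fun j => ((ε j : ℤ) : ℝ) * v j) k ^ 4 -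
        ‖v‖ ^ 4 / (Δ * B : ℕ)) := by
  have hpos : 0 < Δ * B := h ▸ Nat.two_pow_pos m
  have hnorm := norm_walshHadamard_signs ε h v
  simp only [norm_toEuclideanLin_transpose_sub (sht_mem_orthogonalGroup _ ε h)]
  simp only [Matrix.toLpLin_apply, sht_mulVec]
  simpa only [hnorm] using expect_perm_norm_blkclip_sub_sq_le
    (Nat.pos_of_mul_pos_right hpos) (Nat.pos_of_mul_pos_left hpos) (hnorm.trans_le hv)

theorem expectedError_le {m Δ B : ℕ} (h : Δ * B = 2 ^ m)
    {v : EuclideanSpace ℝ (Fin (Δ * B))} (hv : ‖v‖ ≤ 1) :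
    expectedError v ≤ 2 * (‖v‖ ^ 4 - ∑ j, v j ^ 4) / B := by
  have hpos : 0 < Δ * B := h ▸ Nat.two_pow_pos m
  have hΔ : (Δ : ℝ) ≠ 0 := Nat.cast_ne_zero.2 (Nat.pos_of_mul_pos_right hpos).ne'
  have hB : (B : ℝ) ≠ 0 := Nat.cast_ne_zero.2 (Nat.pos_of_mul_pos_left hpos).ne'
  have : Nonempty (Fin (Δ * B)) := ⟨⟨0, hpos⟩⟩
  calc expectedError v
      ≤ 𝔼 ε : Fin (Δ * B) → ℤˣ,
          Δ * (∑ k, (walshHadamard (Δ * B) *ᵥ fun j => ((ε j : ℤ) : ℝ) * v j) k ^ 4 -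
            ‖v‖ ^ 4 / (Δ * B : ℕ)) := by
        rw [expectedError, shtExpectation_eq_expect]
        exact Finset.expect_le_expect fun ε _ =>
          expect_perm_norm_transpose_blkclip_sub_sq_le h ε hv
    _ = 2 * (‖v‖ ^ 4 - ∑ j, v j ^ 4) / B := by
        simp only [← Finset.mul_expect, Finset.expect_sub_distrib, Finset.expect_sum_comm,
          expect_signs_walshHadamard_pow_four, ← EuclideanSpace.real_norm_sq_eq,
          Fintype.expect_const, Finset.sum_const, Finset.card_univ, Fintype.card_fin, nsmul_eq_mul]
        push_cast
        field_simp
        ring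

theorem expectedError_le_log_div {m Δ B : ℕ} (h : Δ * B = 2 ^ m)
    {v : EuclideanSpace ℝ (Fin (Δ * B))} (hv : ‖v‖ ≤ 1) :
    expectedError v ≤ 2 * Real.log (Δ * B : ℕ) / B := by
  have hpos : (0 : ℝ) < (Δ * B : ℕ) := by rw [h]; positivity
  have hcauchySchwarz : ‖v‖ ^ 4 ≤ (Δ * B : ℕ) * ∑ j, v j ^ 4 := by
    have := sq_sum_le_card_mul_sum_sq (s := Finset.univ) (f := fun j => v j ^ 2)
    simpa only [← EuclideanSpace.real_norm_sq_eq, ← pow_mul, Finset.card_univ, Fintype.card_fin]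
      using this
  refine (expectedError_le h hv).trans ?_
  gcongr
  calc ‖v‖ ^ 4 - ∑ j, v j ^ 4
      ≤ ‖v‖ ^ 4 - ‖v‖ ^ 4 / (Δ * B : ℕ) := sub_le_sub_left ((div_le_iff₀' hpos).2 hcauchySchwarz) _
    _ = ‖v‖ ^ 4 * (1 - ((Δ * B : ℕ) : ℝ)⁻¹) := by ring
    _ ≤ 1 * (1 - ((Δ * B : ℕ) : ℝ)⁻¹) := by
      gcongr
      · exact sub_nonneg.2 (inv_le_one_of_one_le₀ (by exact_mod_cast hpos))
      · exact pow_le_one₀ (norm_nonneg v) hv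
    _ ≤ Real.log (Δ * B : ℕ) := by rw [one_mul]; exact Real.one_sub_inv_le_log_of_pos hpos

theorem exists_expectedError_bounds :
    ∃ C : ℝ, 0 < C ∧ ∀ m Δ B : ℕ, Δ * B = 2 ^ m →
      ∀ v : EuclideanSpace ℝ (Fin (Δ * B)), ‖v‖ ≤ 1 →
        expectedError v ≤ C * (Real.log ((Δ * B : ℕ) : ℝ) ^ 2 / (B : ℝ)) ∧
        expectedError v ≤ C * (Real.log ((Δ * B : ℕ) : ℝ) / √(B : ℝ)) := by
  have hlog2 : 0 < Real.log 2 := Real.log_pos one_lt_two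
  refine ⟨2 / Real.log 2, div_pos two_pos hlog2, fun m Δ B h v hv => ?_⟩
  have herror := expectedError_le_log_div h hv
  have hB : (1 : ℝ) ≤ B := Nat.one_le_cast.2 (Nat.pos_of_mul_pos_left (h ▸ Nat.two_pow_pos m))
  have hlogD : Real.log (Δ * B : ℕ) = m * Real.log 2 := by
    rw [h, Nat.cast_pow, Real.log_pow, Nat.cast_ofNat]
  refine ⟨herror.trans ?_, herror.trans ?_⟩ <;> rw [hlogD]
  · have hm : (m : ℝ) ≤ m ^ 2 := mod_cast Nat.le_self_pow two_ne_zero m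
    calc 2 * (m * Real.log 2) / B
        ≤ 2 * (m ^ 2 * Real.log 2) / B := by gcongr
      _ = 2 / Real.log 2 * ((m * Real.log 2) ^ 2 / B) := by field_simp
  · have hsqrt : Real.log 2 * √B ≤ B :=
      calc Real.log 2 * √B
          ≤ 1 * B := by
            gcongr
            · exact (Real.log_two_lt_d9.trans (by norm_num)).le
            · exact Real.sqrt_le_iff.2 ⟨by positivity, le_self_pow₀ hB two_ne_zero⟩
        _ = B := one_mul _
    calc 2 * (m * Real.log 2) / B
        ≤ 2 * (m * Real.log 2) / (Real.log 2 * √B) := by gcongr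
      _ = 2 / Real.log 2 * (m * Real.log 2 / √B) := by field_simp

/-! ### The fast Walsh–Hadamard transform -/

theorem sum_walshSign_succ {k b : ℕ} (c : ℕ) (hb : b < 2 ^ k) (x : ℕ → ℝ) :
    ∑ j ∈ Finset.range (2 ^ (k + 1)), walshSign (k + 1) (2 ^ k * c + b) j * x j =
      ∑ j ∈ Finset.range (2 ^ k), walshSign k b j * x j +
        (if c.testBit 0 = true then -1 else 1) *
          ∑ j ∈ Finset.range (2 ^ k), walshSign k b j * x (2 ^ k + j) := by
  rw [sum_range_two_pow_succ, Finset.mul_sum, ← Finset.sum_add_distrib]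
  refine Finset.sum_congr rfl fun j hj => ?_
  have hj := Finset.mem_range.1 hj
  have hlow : walshSign (k + 1) (2 ^ k * c + b) j = walshSign k b j := by
    simpa using walshSign_two_pow_mul_add c 0 hb hj
  have hhigh : walshSign (k + 1) (2 ^ k * c + b) (2 ^ k * 1 + j) =
      walshSign k b j * if c.testBit 0 = true then -1 else 1 := by
    simpa using walshSign_two_pow_mul_add c 1 hb hj
  rw [hlow, hhigh, mul_one]
  ring

/-- One stage of the fast Walsh–Hadamard transform of a vector of even length `D`: the normalized
sums of the pairs of neighbours `a (2 u)`, `a (2 u + 1)` are put into the lower half and their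
normalized differences into the upper half. All stages are the same, so that one program loop
serves for every stage. -/
noncomputable def butterfly (D : ℕ) (a : ℕ → ℝ) (u : ℕ) : ℝ :=
  if 2 * u < D then (a (2 * u) + a (2 * u + 1)) / √2
  else (a (2 * u - D) - a (2 * u - D + 1)) / √2

theorem butterfly_of_two_mul_lt {D u : ℕ} (hu : 2 * u < D) (a : ℕ → ℝ) :
    butterfly D a u = (a (2 * u) + a (2 * u + 1)) / √2 := if_pos hu

theorem butterfly_add {D h u : ℕ} (hD : D = 2 * h) (a : ℕ → ℝ) :
    butterfly D a (h + u) = (a (2 * u) - a (2 * u + 1)) / √2 := by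
  rw [butterfly, if_neg (by omega), show 2 * (h + u) - D = 2 * u by omega]

theorem butterfly_congr {D u : ℕ} (hD : Even D) (hu : u < D) {a b : ℕ → ℝ}
    (hab : ∀ i < D, a i = b i) : butterfly D a u = butterfly D b u := by
  obtain ⟨h, rfl⟩ := hD
  unfold butterfly
  split_ifs
  · rw [hab _ (by omega), hab _ (by omega)]
  · rw [hab _ (by omega), hab _ (by omega)]

theorem iterate_butterfly_apply {n k r i b : ℕ} (hn : k + r = n) (x : ℕ → ℝ) (hi : i < 2 ^ r)
    (hb : b < 2 ^ k) :
    (butterfly (2 ^ n))^[k] x (2 ^ r * b + i) =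
      (∑ j ∈ Finset.range (2 ^ k), walshSign k b j * x (2 ^ k * i + j)) / √(2 ^ k) := by
  induction k generalizing r i b with
  | zero =>
    obtain rfl : b = 0 := by simpa using hb
    simp
  | succ k ih =>
    obtain ⟨c, b, hc, hb', rfl⟩ : ∃ c b', c < 2 ∧ b' < 2 ^ k ∧ b = 2 ^ k * c + b' :=
      ⟨b / 2 ^ k, b % 2 ^ k, Nat.div_lt_of_lt_mul (by rwa [← pow_succ]),
        Nat.mod_lt _ (by positivity), (Nat.div_add_mod _ _).symm⟩
    have hhalf : 2 ^ n = 2 * 2 ^ (r + k) := by rw [← pow_succ', ← hn]; congr 1; omega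
    have hindex (c : ℕ) : 2 ^ r * (2 ^ k * c + b) + i = 2 ^ (r + k) * c + (2 ^ r * b + i) := by
      ring
    have hdouble : 2 * (2 ^ r * b + i) = 2 ^ (r + 1) * b + 2 * i := by ring
    have hlow : 2 * (2 ^ r * b + i) < 2 ^ n := by
      have : 2 ^ r * (b + 1) ≤ 2 ^ r * 2 ^ k := Nat.mul_le_mul_left _ hb'
      rw [hhalf, pow_add]
      linarith
    have hroot : √(2 ^ (k + 1)) = √(2 ^ k) * √2 := by rw [pow_succ, Real.sqrt_mul (by positivity)]
    have heven := ih (r := r + 1) (by omega) (i := 2 * i) (by omega) hb'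
    have hodd := ih (r := r + 1) (by omega) (i := 2 * i + 1) (by omega) hb'
    have hseg (j : ℕ) : 2 ^ (k + 1) * i + j = 2 ^ k * (2 * i) + j := by ring
    have hseg' (j : ℕ) : 2 ^ k * (2 * i) + (2 ^ k + j) = 2 ^ k * (2 * i + 1) + j := by ring
    rw [Function.iterate_succ_apply', hindex,
      sum_walshSign_succ c hb' fun j => x (2 ^ (k + 1) * i + j), hroot, ← div_div]
    simp only [hseg, hseg']
    -- The lowest digit of the position becomes, transformed, the leading digit `c` of `b`.
    interval_cases c
    · rw [mul_zero, zero_add, butterfly_of_two_mul_lt hlow, hdouble, add_assoc, heven, hodd]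
      simp [add_div]
    · rw [mul_one, butterfly_add hhalf, hdouble, add_assoc, heven, hodd]
      simp [add_div, sub_eq_add_neg, neg_div]

theorem iterate_butterfly_eq_walshHadamard_mulVec {m D : ℕ} (hD : D = 2 ^ m) (x : ℕ → ℝ)
    (i : Fin D) : (butterfly D)^[m] x i = (walshHadamard D *ᵥ fun j => x j) i := by
  subst hD
  rw [walshHadamard_mulVec rfl]
  simpa using iterate_butterfly_apply (add_zero m) x (zero_lt_one.trans_eq (pow_zero 2).symm) i.2

/-! ### Programs with time bounds -/

/-- Total correctness with a time bound: started in `s`, the program `p` halts after at most `T`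
steps in a memory satisfying `Q`. -/
def Reaches (p : Prog) (s : Mem) (T : ℕ) (Q : Mem → Prop) : Prop :=
  ∃ t s', Exec p s t s' ∧ t ≤ T ∧ Q s'

namespace Reaches

variable {p q : Prog} {s : Mem} {T U : ℕ} {P Q : Mem → Prop}

theorem mono (h : Reaches p s T P) (hT : T ≤ U) (hPQ : ∀ t, P t → Q t) : Reaches p s U Q :=
  let ⟨t, s', hexec, ht, hs'⟩ := h
  ⟨t, s', hexec, ht.trans hT, hPQ s' hs'⟩

theorem instr {a : Instr} (h : Q (a.run s)) : Reaches (.instr a) s 1 Q :=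
  ⟨1, a.run s, .instr a s, le_rfl, h⟩

theorem seq (hp : Reaches p s T P) (hq : ∀ t, P t → Reaches q t U Q) :
    Reaches (.seq p q) s (T + U) Q :=
  let ⟨_, s₁, hexec₁, ht₁, hs₁⟩ := hp
  let ⟨_, s₂, hexec₂, ht₂, hs₂⟩ := hq s₁ hs₁
  ⟨_, s₂, hexec₁.seq hexec₂, add_le_add ht₁ ht₂, hs₂⟩

theorem instr_seq {a : Instr} (h : Reaches q (a.run s) T Q) :
    Reaches (.seq (.instr a) q) s (T + 1) Q :=
  let ⟨t, s', hexec, ht, hs'⟩ := h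
  ⟨1 + t, s', .seq (.instr a s) hexec, by omega, hs'⟩

theorem ite {x y : ℕ} (hp : s.idx x < s.idx y → Reaches p s T Q)
    (hq : ¬ s.idx x < s.idx y → Reaches q s T Q) : Reaches (.ite x y p q) s (T + 1) Q := by
  by_cases hxy : s.idx x < s.idx y
  · obtain ⟨t, s', hexec, ht, hs'⟩ := hp hxy
    exact ⟨t + 1, s', .ite_true hxy hexec, Nat.succ_le_succ ht, hs'⟩
  · obtain ⟨t, s', hexec, ht, hs'⟩ := hq hxy
    exact ⟨t + 1, s', .ite_false hxy hexec, Nat.succ_le_succ ht, hs'⟩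

theorem whileLoop {x y N : ℕ} {I : ℕ → Mem → Prop} (h0 : I 0 s)
    (hstep : ∀ k < N, ∀ t, I k t → t.idx x < t.idx y ∧ Reaches p t T (I (k + 1)))
    (hexit : ∀ t, I N t → ¬ t.idx x < t.idx y) :
    Reaches (.while x y p) s (N * (T + 1) + 1) (I N) := by
  induction N generalizing s I with
  | zero => exact ⟨1, s, .while_false (hexit s h0), by omega, h0⟩
  | succ N ih =>
    obtain ⟨hxy, t₁, s₁, hexec₁, ht₁, hs₁⟩ := hstep 0 N.succ_pos s h0
    obtain ⟨t₂, s₂, hexec₂, ht₂, hs₂⟩ :=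
      ih (I := fun k => I (k + 1)) hs₁ (fun k hk => hstep (k + 1) (Nat.succ_lt_succ hk)) hexit
    exact ⟨t₁ + t₂ + 1, s₂, .while_true hxy hexec₁ hexec₂, by linarith, hs₂⟩

end Reaches

/-- Straight-line code: the instruction `a` followed by those of the list. -/
def Prog.straight (a : Instr) : List Instr → Prog
  | [] => .instr a
  | b :: l => .seq (.instr a) (Prog.straight b l)

/-- The memories `s` and `t` agree in the first `n` index registers, in real register `0`, in all
index arrays, and in all real arrays except those named in `A`. This is what the loops below
leave unchanged. -/
structure AgreesOff (n : ℕ) (A : Set ℕ) (s t : Mem) : Prop where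
  idx : ∀ r < n, t.idx r = s.idx r
  val : t.val 0 = s.val 0
  idxArr : t.idxArr = s.idxArr
  valArr : ∀ a ∉ A, t.valArr a = s.valArr a

/-- The instruction changes no index register below `n`, not real register `0`, no index array, and
no real array outside `A`. -/
def Instr.WritesOnly (n : ℕ) (A : Set ℕ) : Instr → Prop
  | .iconst x _ | .iadd x _ _ | .isub x _ _ | .iload x _ _ => n ≤ x
  | .istore _ _ _ => False
  | .rconst x _ | .radd x _ _ | .rsub x _ _ | .rmul x _ _ | .rdiv x _ _ | .rsqrt x _
  | .rload x _ _ => x ≠ 0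
  | .rstore a _ _ => a ∈ A

namespace AgreesOff

variable {n n' : ℕ} {A A' : Set ℕ} {s t u : Mem}

theorem trans (hst : AgreesOff n A s t) (htu : AgreesOff n A t u) : AgreesOff n A s u where
  idx r hr := (htu.idx r hr).trans (hst.idx r hr)
  val := htu.val.trans hst.val
  idxArr := htu.idxArr.trans hst.idxArr
  valArr a ha := (htu.valArr a ha).trans (hst.valArr a ha)

theorem mono (h : AgreesOff n A s t) (hn : n' ≤ n) (hA : A ⊆ A') : AgreesOff n' A' s t where
  idx r hr := h.idx r (hr.trans_le hn)
  val := h.val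
  idxArr := h.idxArr
  valArr a ha := h.valArr a fun haA => ha (hA haA)

theorem run {a : Instr} (ha : a.WritesOnly n A) (s : Mem) : AgreesOff n A s (a.run s) := by
  cases a with
  | iconst | iadd | isub | iload =>
    exact ⟨fun r hr => Function.update_of_ne (hr.trans_le ha).ne .., rfl, rfl, fun _ _ => rfl⟩
  | istore => exact ha.elim
  | rconst | radd | rsub | rmul | rdiv | rsqrt | rload =>
    exact ⟨fun _ _ => rfl, Function.update_of_ne (Ne.symm ha) .., rfl, fun _ _ => rfl⟩
  | rstore =>
    exact ⟨fun _ _ => rfl, rfl, rfl,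
      fun _ hb => Function.update_of_ne (ne_of_mem_of_not_mem ha hb).symm ..⟩

end AgreesOff

theorem Reaches.agreesOff_trans {p : Prog} {s s' : Mem} {T n : ℕ} {A : Set ℕ} {Q : Mem → Prop}
    (hs : AgreesOff n A s s') (h : Reaches p s' T fun t => AgreesOff n A s' t ∧ Q t) :
    Reaches p s' T fun t => AgreesOff n A s t ∧ Q t :=
  h.mono le_rfl fun _ ⟨ht, hQ⟩ => ⟨hs.trans ht, hQ⟩

theorem Reaches.straight_agreesOff {a : Instr} {l : List Instr} {s : Mem} {n : ℕ} {A : Set ℕ}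
    {Q : Mem → Prop} (hwrites : ∀ b ∈ a :: l, b.WritesOnly n A)
    (h : Q (l.foldl (fun t b => b.run t) (a.run s))) :
    Reaches (.straight a l) s (l.length + 1) fun t => AgreesOff n A s t ∧ Q t := by
  induction l generalizing a s with
  | nil => exact .instr ⟨.run (hwrites a (by simp)) s, h⟩
  | cons b l ih =>
    exact instr_seq <| agreesOff_trans (.run (hwrites a (by simp)) s)
      (ih (fun c hc => hwrites c (List.mem_cons_of_mem a hc)) h)

/-- `for idx 3 = 0, …, idx 0 - 1 do body`, provided that index register `1` holds `1`. -/
def Prog.forLoop (body : Prog) : Prog :=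
  .seq (.instr (.iconst 3 0)) (.while 3 0 (.seq body (.instr (.iadd 3 3 1))))

theorem Reaches.forLoop {body : Prog} {T D b : ℕ} {c : ℕ → ℕ} {f : ℕ → ℝ} {s : Mem}
    (hD : s.idx 0 = D) (h1 : s.idx 1 = 1) (hc : Set.InjOn c (Set.Iio D))
    (hbody : ∀ t, t.idx 3 < D → AgreesOff 3 {b} s t → Reaches body t T fun u =>
      AgreesOff 4 {b} t u ∧
        u.valArr b = Function.update (t.valArr b) (c (t.idx 3)) (f (t.idx 3))) :
    Reaches (.forLoop body) s ((T + 2) * D + 2) fun t =>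
      AgreesOff 3 {b} s t ∧ ∀ i < D, t.valArr b (c i) = f i := by
  let I (k : ℕ) (t : Mem) : Prop :=
    AgreesOff 3 {b} s t ∧ t.idx 3 = k ∧ ∀ i < k, t.valArr b (c i) = f i
  have hstep (k : ℕ) (hk : k < D) (t : Mem) (ht : I k t) : t.idx 3 < t.idx 0 ∧
      Reaches (.seq body (.instr (.iadd 3 3 1))) t (T + 1) (I (k + 1)) := by
    obtain ⟨hst, rfl, hfill⟩ := ht
    refine ⟨by rwa [hst.idx 0 (by omega), hD], (hbody t hk hst).seq fun u ⟨htu, hu⟩ => .instr ?_⟩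
    refine ⟨(hst.trans (htu.mono (by omega) subset_rfl)).trans (.run le_rfl u), ?_, ?_⟩
    · simp only [Instr.run, Function.update_self]
      rw [htu.idx 3 (by omega), htu.idx 1 (by omega), hst.idx 1 (by omega), h1]
    · intro i hi
      simp only [Instr.run, hu]
      rcases (Nat.lt_succ_iff_lt_or_eq.1 hi) with hi | rfl
      · rw [Function.update_of_ne (hc.ne (hi.trans hk) hk hi.ne), hfill i hi]
      · rw [Function.update_self]
  have hexit (t : Mem) (ht : I D t) : ¬ t.idx 3 < t.idx 0 := by
    rw [ht.2.1, ht.1.idx 0 (by omega), hD]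
    exact lt_irrefl D
  have hinit : I 0 ((Instr.iconst 3 0).run s) :=
    ⟨.run le_rfl s, by simp [Instr.run], fun i hi => absurd hi i.not_lt_zero⟩
  exact (instr_seq (whileLoop hinit hstep hexit)).mono (by linarith)
    fun t ht => ⟨ht.1, ht.2.2⟩

theorem Reaches.forLoop_straight {a : Instr} {l : List Instr} {T D b : ℕ} {c : ℕ → ℕ} {f : ℕ → ℝ}
    {s : Mem} (hD : s.idx 0 = D) (h1 : s.idx 1 = 1) (hc : Set.InjOn c (Set.Iio D))
    (hT : l.length + 3 ≤ T) (hwrites : ∀ a' ∈ a :: l, a'.WritesOnly 4 {b})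
    (hrun : ∀ t, t.idx 3 < D → AgreesOff 3 {b} s t →
      (l.foldl (fun u a' => a'.run u) (a.run t)).valArr b =
        Function.update (t.valArr b) (c (t.idx 3)) (f (t.idx 3))) :
    Reaches (.forLoop (.straight a l)) s (T * D + 2) fun t =>
      AgreesOff 3 {b} s t ∧ ∀ i < D, t.valArr b (c i) = f i :=
  (forLoop hD h1 hc fun t ht hst => straight_agreesOff hwrites (hrun t ht hst)).mono
    (by gcongr) fun _ => id

/-! ### A program for the fast Walsh–Hadamard transform -/

/-- The constants that the programs keep in registers: the length `D`, the index `1` and the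
real `√2`. -/
structure HasConstants (D : ℕ) (s : Mem) : Prop where
  length : s.idx 0 = D
  one : s.idx 1 = 1
  sqrtTwo : s.val 0 = √2

theorem HasConstants.of_agreesOff {D n : ℕ} {A : Set ℕ} {s t : Mem} (hs : HasConstants D s)
    (hn : 2 ≤ n) (h : AgreesOff n A s t) : HasConstants D t where
  length := (h.idx 0 (by omega)).trans hs.length
  one := (h.idx 1 (by omega)).trans hs.one
  sqrtTwo := h.val.trans hs.sqrtTwo

/-- Writes entry `u` of the `butterfly` of real array `3` to real array `4`, where `u` is the
content of index register `3`. -/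
def butterflyBody : Prog :=
  .seq (.instr (.iadd 4 3 3)) (.ite 4 0
    (.straight (.iadd 5 4 1)
      [.rload 1 3 4, .rload 2 3 5, .radd 1 1 2, .rdiv 1 1 0, .rstore 4 3 1])
    (.straight (.isub 4 4 0)
      [.iadd 5 4 1, .rload 1 3 4, .rload 2 3 5, .rsub 1 1 2, .rdiv 1 1 0, .rstore 4 3 1]))

theorem reaches_butterflyBody {D : ℕ} {s : Mem} (hs : HasConstants D s) :
    Reaches butterflyBody s 9 fun t => AgreesOff 4 {4} s t ∧
      t.valArr 4 = Function.update (s.valArr 4) (s.idx 3) (butterfly D (s.valArr 3) (s.idx 3)) := by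
  obtain ⟨rfl, hone, hsqrt⟩ := hs
  refine .instr_seq <| .agreesOff_trans (.run le_rfl s) <|
    .ite (T := 7) (fun hlt => ?_) fun hge => ?_
  · have hlt : 2 * s.idx 3 < s.idx 0 := by simpa [Instr.run, two_mul] using hlt
    refine (Reaches.straight_agreesOff (by simp [Instr.WritesOnly]) ?_).mono (by simp) fun _ => id
    simp [Instr.run, writeArr, hone, hsqrt, butterfly, hlt, ← two_mul]
  · have hge : ¬ 2 * s.idx 3 < s.idx 0 := by simpa [Instr.run, two_mul] using hge
    refine .straight_agreesOff (by simp [Instr.WritesOnly]) ?_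
    simp [Instr.run, writeArr, hone, hsqrt, butterfly, hge, ← two_mul]

/-- One stage of the transform of real array `3`, with real array `4` as scratch space. -/
def butterflyStage : Prog :=
  .seq (.forLoop butterflyBody) (.forLoop (.straight (.rload 1 4 3) [.rstore 3 3 1]))

theorem reaches_butterflyStage {D : ℕ} {s : Mem} (hs : HasConstants D s) :
    Reaches butterflyStage s (15 * D + 4) fun t => AgreesOff 3 {3, 4} s t ∧
      ∀ i < D, t.valArr 3 i = butterfly D (s.valArr 3) i := by
  have hcompute := Reaches.forLoop (b := 4) (f := butterfly D (s.valArr 3)) hs.length hs.one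
    Function.injective_id.injOn fun t _ hst => by
      rw [← hst.valArr 3 (by simp)]
      exact reaches_butterflyBody (hs.of_agreesOff (by omega) hst)
  have hcopy (t : Mem) (ht : HasConstants D t) :=
    Reaches.forLoop_straight (a := .rload 1 4 3) (l := [.rstore 3 3 1]) (T := 4) (b := 3)
      (f := t.valArr 4) ht.length ht.one Function.injective_id.injOn (by simp)
      (by simp [Instr.WritesOnly])
      fun u _ htu => by simp [Instr.run, writeArr, htu.valArr 4]
  refine (hcompute.seq fun t ⟨hst, ht⟩ => (hcopy t (hs.of_agreesOff (by omega) hst)).mono le_rfl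
    fun u ⟨htu, hu⟩ => ?_).mono (by linarith) fun _ => id
  refine ⟨(hst.mono le_rfl (by simp)).trans (htu.mono le_rfl (by simp)), fun i hi => ?_⟩
  exact (hu i hi).trans (ht i hi)

/-- The fast Walsh–Hadamard transform of real array `3`, with real array `4` as scratch space. The
number of stages, `log₂ D`, is obtained by doubling index register `2` until it reaches `D`. -/
def hadamardProg : Prog :=
  .seq (.instr (.iconst 2 1)) (.while 2 0 (.seq butterflyStage (.instr (.iadd 2 2 2))))

theorem reaches_hadamardProg {m D : ℕ} {s : Mem} (hs : HasConstants D s) (hD : D = 2 ^ m) :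
    Reaches hadamardProg s (m * (15 * D + 6) + 2) fun t => AgreesOff 2 {3, 4} s t ∧
      ∀ i : Fin D, t.valArr 3 i = (walshHadamard D *ᵥ fun j => s.valArr 3 j) i := by
  let I (k : ℕ) (t : Mem) : Prop := AgreesOff 2 {3, 4} s t ∧ t.idx 2 = 2 ^ k ∧
    ∀ i < D, t.valArr 3 i = (butterfly D)^[k] (s.valArr 3) i
  have hstep (k : ℕ) (hk : k < m) (t : Mem) (ht : I k t) : t.idx 2 < t.idx 0 ∧
      Reaches (.seq butterflyStage (.instr (.iadd 2 2 2))) t (15 * D + 5) (I (k + 1)) := by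
    obtain ⟨hst, h2, htrans⟩ := ht
    have hconst := hs.of_agreesOff le_rfl hst
    have heven : Even D := ⟨2 ^ (m - 1), by rw [hD, ← two_mul, mul_pow_sub_one (by omega)]⟩
    refine ⟨by rw [h2, hconst.length, hD]; exact Nat.pow_lt_pow_right one_lt_two hk,
      (reaches_butterflyStage hconst).seq fun u ⟨htu, hu⟩ => .instr ⟨?_, ?_, fun i hi => ?_⟩⟩
    · exact hst.trans ((htu.mono (by omega) subset_rfl).trans (.run le_rfl u))
    · simp [Instr.run, htu.idx 2, h2, pow_succ, mul_two]
    · rw [Function.iterate_succ_apply', ← butterfly_congr heven hi htrans]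
      exact hu i hi
  have hexit (t : Mem) (ht : I m t) : ¬ t.idx 2 < t.idx 0 := by
    rw [ht.2.1, (hs.of_agreesOff le_rfl ht.1).length, hD]
    exact lt_irrefl _
  have hinit : I 0 ((Instr.iconst 2 1).run s) :=
    ⟨.run le_rfl s, by simp [Instr.run], fun i _ => rfl⟩
  refine (Reaches.instr_seq (.whileLoop hinit hstep hexit)).mono (by linarith)
    fun t ht => ⟨ht.1, fun i => ?_⟩
  rw [← iterate_butterfly_eq_walshHadamard_mulVec hD]
  exact ht.2.2 i i.2

/-! ### Programs for `S H T` and its transpose -/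

/-- The transform between two loops: `load` fills real array `3` entry by entry, and `store` reads
the transformed entries off from it. -/
def hadamardBetween (load store : Prog) : Prog :=
  .seq (.instr (.iconst 1 1)) <| .seq (.instr (.rconst 0 2)) <| .seq (.instr (.rsqrt 0 0)) <|
    .seq (.forLoop load) <| .seq hadamardProg (.forLoop store)

/-- `y i := ε i * x i`, where `y` is real array `3`. -/
def signedLoad : Prog := .straight (.rload 1 0 3) [.rload 2 1 3, .rmul 1 2 1, .rstore 3 3 1]

/-- `z i := y (σ i)`, where `y` is real array `3` and the output `z` is real array `2`. -/
def permutedStore : Prog := .straight (.iload 4 0 3) [.rload 1 3 4, .rstore 2 3 1]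

/-- `y (σ i) := x i`, where `y` is real array `3`. -/
def permutedLoad : Prog := .straight (.iload 4 0 3) [.rload 1 0 3, .rstore 3 4 1]

/-- `z i := ε i * y i`, where `y` is real array `3` and the output `z` is real array `2`. -/
def signedStore : Prog := .straight (.rload 1 3 3) [.rload 2 1 3, .rmul 1 2 1, .rstore 2 3 1]

section HadamardBetween

variable {m D : ℕ} {σ : Equiv.Perm (Fin D)} {ε : Fin D → ℤˣ} {x : Fin D → ℝ} {s : Mem}

theorem IsInput.of_agreesOff {n : ℕ} {A : Set ℕ} {t : Mem} (hs : IsInput σ ε x s) (hn : 0 < n)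
    (h0 : 0 ∉ A) (h1 : 1 ∉ A) (h : AgreesOff n A s t) : IsInput σ ε x t := by
  rw [IsInput, h.idx 0 hn, h.idxArr, h.valArr 0 h0, h.valArr 1 h1]
  exact hs

theorem reaches_signedLoad (hc : HasConstants D s) (hs : IsInput σ ε x s) :
    Reaches (.forLoop signedLoad) s (6 * D + 2) fun t =>
      AgreesOff 3 {3} s t ∧ ∀ i : Fin D, t.valArr 3 i = ((ε i : ℤ) : ℝ) * x i := by
  refine (Reaches.forLoop_straight (b := 3) (f := fun i => s.valArr 1 i * s.valArr 0 i)
    hc.length hc.one Function.injective_id.injOn (by simp) (by simp [Instr.WritesOnly])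
    fun t _ hst => ?_).mono le_rfl fun t ⟨hst, ht⟩ => ⟨hst, fun i => ?_⟩
  · simp [Instr.run, writeArr, hst.valArr]
  · rw [← (hs.2 i).2.1, ← (hs.2 i).2.2]
    exact ht i i.2

theorem reaches_permutedStore (hc : HasConstants D s) (hs : IsInput σ ε x s) :
    Reaches (.forLoop permutedStore) s (6 * D + 2) fun t =>
      ∀ i : Fin D, t.valArr 2 i = s.valArr 3 (σ i) := by
  refine (Reaches.forLoop_straight (b := 2) (f := fun i => s.valArr 3 (s.idxArr 0 i))
    hc.length hc.one Function.injective_id.injOn (by simp) (by simp [Instr.WritesOnly])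
    fun t _ hst => ?_).mono le_rfl fun t ⟨_, ht⟩ i => ?_
  · simp [Instr.run, writeArr, hst.valArr, hst.idxArr]
  · rw [← (hs.2 i).1]
    exact ht i i.2

theorem reaches_permutedLoad (hc : HasConstants D s) (hs : IsInput σ ε x s) :
    Reaches (.forLoop permutedLoad) s (6 * D + 2) fun t =>
      AgreesOff 3 {3} s t ∧ ∀ i : Fin D, t.valArr 3 i = x (σ.symm i) := by
  have hperm (i : ℕ) (hi : i < D) : s.idxArr 0 i = σ ⟨i, hi⟩ := (hs.2 ⟨i, hi⟩).1
  have hinj : Set.InjOn (s.idxArr 0) (Set.Iio D) := fun i hi j hj hij => by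
    rw [hperm i hi, hperm j hj] at hij
    exact Fin.mk.inj (σ.injective (Fin.ext hij))
  refine (Reaches.forLoop_straight (b := 3) (f := s.valArr 0)
    hc.length hc.one hinj (by simp) (by simp [Instr.WritesOnly])
    fun t _ hst => ?_).mono le_rfl fun t ⟨hst, ht⟩ => ⟨hst, fun i => ?_⟩
  · simp [Instr.run, writeArr, hst.valArr, hst.idxArr]
  · have hi := ht (σ.symm i) (σ.symm i).2
    rwa [(hs.2 (σ.symm i)).1, (hs.2 (σ.symm i)).2.1, Equiv.apply_symm_apply] at hi

theorem reaches_signedStore (hc : HasConstants D s) (hs : IsInput σ ε x s) :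
    Reaches (.forLoop signedStore) s (6 * D + 2) fun t =>
      ∀ i : Fin D, t.valArr 2 i = ((ε i : ℤ) : ℝ) * s.valArr 3 i := by
  refine (Reaches.forLoop_straight (b := 2) (f := fun i => s.valArr 1 i * s.valArr 3 i)
    hc.length hc.one Function.injective_id.injOn (by simp) (by simp [Instr.WritesOnly])
    fun t _ hst => ?_).mono le_rfl fun t ⟨_, ht⟩ i => ?_
  · simp [Instr.run, writeArr, hst.valArr]
  · rw [← (hs.2 i).2.2]
    exact ht i i.2

theorem reaches_hadamardBetween (hD : D = 2 ^ m) (hs : IsInput σ ε x s) {load store : Prog}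
    {y z : Fin D → ℝ}
    (hload : ∀ t, HasConstants D t → IsInput σ ε x t → Reaches (.forLoop load) t (6 * D + 2)
      fun u => AgreesOff 3 {3} t u ∧ ∀ i : Fin D, u.valArr 3 i = y i)
    (hstore : ∀ t, HasConstants D t → IsInput σ ε x t →
      (∀ i : Fin D, t.valArr 3 i = (walshHadamard D *ᵥ y) i) →
        Reaches (.forLoop store) t (6 * D + 2) fun u => ∀ i : Fin D, u.valArr 2 i = z i) :
    Reaches (hadamardBetween load store) s (21 * ((m + 1) * D))
      fun t => ∀ i : Fin D, t.valArr 2 i = z i := by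
  let t := (Instr.rsqrt 0 0).run ((Instr.rconst 0 2).run ((Instr.iconst 1 1).run s))
  have hct : HasConstants D t := ⟨hs.1, by simp [t, Instr.run], by simp [t, Instr.run]⟩
  have ht : IsInput σ ε x t := hs
  have hD0 : 0 < D := by rw [hD]; positivity
  refine (Reaches.instr_seq <| .instr_seq <| .instr_seq <| (hload t hct ht).seq fun u ⟨htu, hu⟩ =>
    have hcu := hct.of_agreesOff (by omega) htu
    have hu' := ht.of_agreesOff (by omega) (by simp) (by simp) htu
    (reaches_hadamardProg hcu hD).seq fun v ⟨huv, hv⟩ =>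
      hstore v (hcu.of_agreesOff le_rfl huv)
        (hu'.of_agreesOff two_pos (by simp) (by simp) huv) ?_).mono (by nlinarith) fun _ => id
  simpa only [hu] using hv

end HadamardBetween

theorem multipliesWithin_of_reaches
    {f : ∀ {D : ℕ}, Matrix (Fin D) (Fin D) ℝ → Matrix (Fin D) (Fin D) ℝ} {p : Prog} {C : ℕ}
    (h : ∀ (m D : ℕ), D = 2 ^ m → ∀ (σ : Equiv.Perm (Fin D)) (ε : Fin D → ℤˣ) (x : Fin D → ℝ)
      (s : Mem), IsInput σ ε x s → Reaches p s (C * ((m + 1) * D))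
        fun t => ∀ i : Fin D, t.valArr 2 i = (f (sht σ ε) *ᵥ x) i) :
    MultipliesWithin f p (2 * C / Real.log 2) := by
  intro m D hD σ ε x s hs
  obtain ⟨t, s', hexec, ht, hs'⟩ := h m D hD σ ε x s hs
  refine ⟨t, s', hexec, hs', fun h2 => ?_⟩
  have hm : 1 ≤ m := Nat.one_le_iff_ne_zero.2 fun hm => by simp [hD, hm] at h2
  have hbound : C * ((m + 1) * D) ≤ 2 * C * (m * D) := by
    calc C * ((m + 1) * D) ≤ C * ((m + m) * D) := by gcongr
      _ = 2 * C * (m * D) := by ring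
  calc (t : ℝ) ≤ 2 * C * (m * D) := by exact_mod_cast ht.trans hbound
    _ = 2 * C / Real.log 2 * (D * Real.log D) := by
      rw [hD, Nat.cast_pow, Real.log_pow]
      field_simp
      simp

theorem exists_multipliesWithin : ∃ p K, MultipliesWithin (fun W => W) p K :=
  ⟨hadamardBetween signedLoad permutedStore, _, multipliesWithin_of_reaches fun _ _ hD _ _ _ _ hs =>
    reaches_hadamardBetween hD hs (fun _ => reaches_signedLoad) fun _ hc ht hy =>
      (reaches_permutedStore hc ht).mono le_rfl fun _ hz i => by
        rw [hz, hy, sht_mulVec, Function.comp_apply]⟩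

theorem exists_multipliesWithin_transpose :
    ∃ p K, MultipliesWithin (fun W => Matrix.transpose W) p K :=
  ⟨hadamardBetween permutedLoad signedStore, _, multipliesWithin_of_reaches fun _ _ hD _ _ _ _ hs =>
    reaches_hadamardBetween hD hs (fun _ => reaches_permutedLoad) fun _ hc ht hy =>
      (reaches_signedStore hc ht).mono le_rfl fun _ hz i => by
        rw [hz, hy, sht_transpose_mulVec]; rfl⟩

end SHT

theorem mainTheorem7 :
    (∃ C : ℝ, 0 < C ∧ ∀ m Δ B : ℕ, Δ * B = 2 ^ m →
      ∀ v : EuclideanSpace ℝ (Fin (Δ * B)), ‖v‖ ≤ 1 →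
        SHT.expectedError v ≤ C * (Real.log ((Δ * B : ℕ) : ℝ) ^ 2 / (B : ℝ)) ∧
        SHT.expectedError v ≤ C * (Real.log ((Δ * B : ℕ) : ℝ) / Real.sqrt (B : ℝ))) ∧
    (∃ (p : SHT.Prog) (K : ℝ), SHT.MultipliesWithin (fun W => W) p K) ∧
    (∃ (p : SHT.Prog) (K : ℝ), SHT.MultipliesWithin (fun W => Matrix.transpose W) p K) :=
  ⟨SHT.exists_expectedError_bounds, SHT.exists_multipliesWithin,
    SHT.exists_multipliesWithin_transpose⟩
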